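/- Let $n\ge 1$, let $\Delta=[e_0,e_1,\dots,e_n]\subset\mathbb{R}^n$ be the standard simplex ($e_0=0$ and $e_1,\dots,e_n$ the canonical basis), and let $p,q\in\mathbb{R}[X_1,\dots,X_n]$ be polynomials of degree at most $l$, $f=p/q$. Bernstein coefficients. For a non-degenerate simplex $V=[v_0,\dots,v_n]$ with barycentric coordinates $\lambda=(\lambda_0,\dots,\lambda_n)$, the Bernstein coefficients $b_\alpha(p,l,V)$ ($\alpha\in\mathbb{N}^{n+1}$, $|\alpha|=l$) are the unique reals with $p=\sum_{|\alpha|=l} b_\alpha(p,l,V)\,\frac{l!}{\alpha_0!\cdots\alpha_n!}\lambda^\alpha$, and $b_\alpha(f,l,V)=b_\alpha(p,l,V)/b_\alpha(q,l,V)$. Assume $b_\alpha(q,l,\Delta)>0$ for all $|\alpha|=l$. With $\epsilon_0,\dots,\epsilon_n$ the canonical basis of $\mathbb{R}^{n+1}$ and $\epsilon_{-1}:=\epsilon_n$, let $$\|\nabla^2p\|_\infty=\max_{|\gamma|=l-2,\;0\le i<j\le n}\left|b_{\gamma+\epsilon_i+\epsilon_{j-1}}+b_{\gamma+\epsilon_{i-1}+\epsilon_j}-b_{\gamma+\epsilon_{i-1}+\epsilon_{j-1}}-b_{\gamma+\epsilon_i+\epsilon_j}\right|,\qquad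 b_\beta=b_\beta(p,l,\Delta)$$ (equal to $0$ if $l\le 1$), and likewise for $q$. Put $$\zeta=\max\Big\{\big|\min_{|\alpha|=l}b_\alpha(f,l,\Delta)\big|,\ \big|\max_{|\alpha|=l}b_\alpha(f,l,\Delta)\big|\Big\},$$ $$\omega'=l\,\frac{n^2(n+1)(n+2)^2(n+3)}{576\,\min_{|\alpha|=l}b_\alpha(q,l,\Delta)}\big(\|\nabla^2p\|_\infty+\zeta\,\|\nabla^2q\|_\infty\big).$$ Subdivision. A subdivision of a non-degenerate simplex $V$ is a finite list of non-degenerate simplices with union $V$ and pairwise disjoint interiors. A subdivision scheme $S$ assigns to every non-degenerate simplex $V$ of $\mathbb{R}^n$ a subdivision $S(V)$; $S^N(V)$ is the list obtained after $N$ successive steps ($S^0(V)=(V)$). $S$ has shrinking factor $C$, $0<C<1$, if for every $V$ all simplices of $S(V)$ have Euclidean diameter at most $C$ times the diameter of $V$. Claim. Suppose that $f(x)>0$ for all $x\in\Delta$, and put $\underline f=\min_{x\in\Delta}f(x)$. Let $S$ be a subdivision scheme with shrinking factor $C<1$ and let $N\ge 0$ be an integer with $$\frac1{C^N}>\frac{\sqrt{2\omega'}}{\sqrt{\underline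 f}}.$$ Then $f$ satisfies the local certificate of positivity associated to $S^N(\Delta)$: for every simplex $U$ of $S^N(\Delta)$ one has $b_\alpha(q,l,U)>0$ for all $|\alpha|=l$ (so that the $b_\alpha(f,l,U)$ are well defined), $b_\alpha(f,l,U)\ge 0$ for all $|\alpha|=l$, and $b_{l\epsilon_i}(f,l,U)>0$ for $i=0,\dots,n$. -/

import Mathlib

namespace RatBernstein

/-- Euclidean space `ℝⁿ`. -/
abbrev Space (n : ℕ) : Type := EuclideanSpace ℝ (Fin n)

/-- A non-degenerate simplex `V = [v₀, …, vₙ]` of `ℝⁿ`: an ordered list of `n + 1` affinely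
independent points. -/
abbrev Simplex (n : ℕ) : Type := Affine.Simplex ℝ (Space n) n

/-- The realization `|V|`: the convex hull of the vertices. -/
def realization {n : ℕ} (V : Simplex n) : Set (Space n) := convexHull ℝ (Set.range V.points)

/-- The mesh of a simplex: its (Euclidean) diameter. -/
noncomputable def mesh {n : ℕ} (V : Simplex n) : ℝ := Metric.diam (realization V)

/-- The vertices `0, e₁, …, eₙ` of the standard simplex. -/
noncomputable def stdVertex (n : ℕ) : Fin (n + 1) → Space n :=
  Fin.cons 0 (fun i => EuclideanSpace.single i (1 : ℝ))

theorem affineIndependent_stdVertex (n : ℕ) : AffineIndependent ℝ (stdVertex n) := by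
  rw [affineIndependent_iff]
  intro s w hw hs
  classical
  set u : Fin (n + 1) → ℝ := fun i => if i ∈ s then w i else 0 with hu
  have h0 : ∑ i, u i = 0 := by
    rw [← hw]; simp [hu, Finset.sum_ite_mem]
  have h1 : ∑ i, u i • stdVertex n i = 0 := by
    rw [← hs]; simp [hu, ite_smul, Finset.sum_ite_mem]
  have h2 : ∀ j : Fin n, u j.succ = 0 := by
    intro j
    have := congrArg (fun v : Space n => v j) h1
    simpa [Fin.sum_univ_succ, stdVertex, Pi.single_apply] using this
  have h3 : u 0 = 0 := by
    simpa [Fin.sum_univ_succ, h2] using h0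
  intro i hi
  have h4 : u i = 0 := by
    refine Fin.cases h3 h2 i
  simpa [hu, hi] using h4

/-- The standard simplex `Δ = [e₀, e₁, …, eₙ]` with `e₀ = 0`. -/
noncomputable def stdSimplex (n : ℕ) : Simplex n := ⟨stdVertex n, affineIndependent_stdVertex n⟩

/-- The multi-indices `α = (α₀, …, αₙ) ∈ ℕⁿ⁺¹` with `|α| = k`. -/
def multiIndices (n k : ℕ) : Finset (Fin (n + 1) → ℕ) := Finset.piAntidiag Finset.univ k

theorem mem_multiIndices {n k : ℕ} {α : Fin (n + 1) → ℕ} :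
    α ∈ multiIndices n k ↔ ∑ i, α i = k := by
  simp [multiIndices, Finset.mem_piAntidiag]

theorem multiIndices_nonempty (n k : ℕ) : (multiIndices n k).Nonempty :=
  ⟨Pi.single 0 k, by simp [mem_multiIndices]⟩

/-- The Bernstein polynomial `B_α^{(k)}(lam) = (k choose α) lam^α` in barycentric
coordinates `lam`, where `k = |α|`. -/
noncomputable def bernsteinPoly {n : ℕ} (α : Fin (n + 1) → ℕ) (lam : Fin (n + 1) → ℝ) : ℝ :=
  (Nat.multinomial Finset.univ α : ℝ) * ∏ i, lam i ^ α i

/-- `b` is the family of Bernstein coefficients of degree `k` of `p` with respect to `V`: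
`p(x) = ∑_{|α| = k} b_α B_α^{(k)}(lam)` for every point `x = ∑ lamᵢ vᵢ` with barycentric
coordinates `lam`. Off the multi-indices with `|α| = k`, `b` is set to `0`. -/
def IsBernsteinCoeff {n : ℕ} (p : MvPolynomial (Fin n) ℝ) (k : ℕ) (V : Simplex n)
    (b : (Fin (n + 1) → ℕ) → ℝ) : Prop :=
  (∀ lam : Fin (n + 1) → ℝ, ∑ i, lam i = 1 →
    MvPolynomial.eval (fun j => (∑ i, lam i • V.points i) j) p =
      ∑ α ∈ multiIndices n k, b α * bernsteinPoly α lam) ∧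
  ∀ α, α ∉ multiIndices n k → b α = 0

theorem multinomial_ne_zero {n : ℕ} (α : Fin (n + 1) → ℕ) :
    (Nat.multinomial Finset.univ α : ℝ) ≠ 0 :=
  Nat.cast_ne_zero.mpr (Nat.multinomial_pos _ _).ne'

theorem exists_isBernsteinCoeff {n : ℕ} (p : MvPolynomial (Fin n) ℝ) (k : ℕ) (V : Simplex n)
    (hp : p.totalDegree ≤ k) : ∃ b, IsBernsteinCoeff p k V b := by
  classical
  let F : MvPolynomial (Fin (n + 1)) ℝ := ∑ β ∈ p.support,
    MvPolynomial.C (p.coeff β) *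
      (∏ j, (∑ i, MvPolynomial.C (V.points i j) * MvPolynomial.X i) ^ β j) *
      (∑ i, MvPolynomial.X i) ^ (k - ∑ j, β j)
  have hF : F.IsHomogeneous k := by
    refine MvPolynomial.IsHomogeneous.sum _ _ _ fun β hβ => ?_
    have hk : ∑ j, β j ≤ k := by
      refine le_trans ?_ hp
      have := MvPolynomial.le_totalDegree hβ
      simpa [Finsupp.sum_fintype] using this
    have e : k = 0 + ∑ j, 1 * β j + 1 * (k - ∑ j, β j) := by
      simp only [one_mul, zero_add]; omega
    rw [e]
    have hh : k - ∑ j, β j = 0 + ∑ j, 1 * β j + 1 * (k - ∑ j, β j) - ∑ j, β j := by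
      simp only [one_mul, zero_add]; omega
    rw [← hh]
    refine ((MvPolynomial.isHomogeneous_C _ _).mul
      (MvPolynomial.IsHomogeneous.prod _ _ _ fun j _ => ?_)).mul ?_
    · refine MvPolynomial.IsHomogeneous.pow ?_ _
      refine MvPolynomial.IsHomogeneous.sum _ _ _ fun i _ => ?_
      simpa using (MvPolynomial.isHomogeneous_C _ (V.points i j)).mul
        (MvPolynomial.isHomogeneous_X ℝ i)
    · refine MvPolynomial.IsHomogeneous.pow ?_ _
      exact MvPolynomial.IsHomogeneous.sum _ _ _ fun i _ => MvPolynomial.isHomogeneous_X ℝ i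
  refine ⟨fun α => if α ∈ multiIndices n k then
    F.coeff (Finsupp.equivFunOnFinite.symm α) / Nat.multinomial Finset.univ α else 0, ?_, ?_⟩
  · intro lam hlam
    have h1 : MvPolynomial.eval (fun j => (∑ i, lam i • V.points i) j) p =
        MvPolynomial.eval lam F := by
      rw [MvPolynomial.eval_eq' _ p]
      simp only [F, map_sum, map_mul, map_prod, map_pow, MvPolynomial.eval_C,
        MvPolynomial.eval_X, hlam, one_pow, mul_one]
      refine Finset.sum_congr rfl fun β _ => ?_
      congr 1
      refine Finset.prod_congr rfl fun j _ => ?_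
      congr 1
      simp [mul_comm]
    rw [h1, MvPolynomial.eval_eq']
    have h2 : ∀ α ∈ multiIndices n k,
        (if α ∈ multiIndices n k then
          F.coeff (Finsupp.equivFunOnFinite.symm α) / Nat.multinomial Finset.univ α else 0)
          * bernsteinPoly α lam =
        F.coeff (Finsupp.equivFunOnFinite.symm α) * ∏ i, lam i ^ α i := by
      intro α hα
      rw [if_pos hα, bernsteinPoly]
      have := multinomial_ne_zero α
      field_simp
    rw [Finset.sum_congr rfl h2]
    refine Finset.sum_bij_ne_zero (fun d _ _ => ⇑d) ?_ ?_ ?_ ?_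
    · intro d hd _
      rw [mem_multiIndices]
      have := hF (MvPolynomial.mem_support_iff.mp hd)
      simpa [Finsupp.weight_apply, Finsupp.sum_fintype] using this
    · intro d _ _ d' _ _ h
      exact DFunLike.coe_injective h
    · intro α hα hne
      refine ⟨Finsupp.equivFunOnFinite.symm α, ?_, ?_, ?_⟩
      · rw [MvPolynomial.mem_support_iff]; exact left_ne_zero_of_mul hne
      · simpa using hne
      · simp
    · intro d _ _
      have : Finsupp.equivFunOnFinite.symm (⇑d) = d := by ext; simp
      rw [this]
  · intro α hα
    simp [hα]

theorem IsBernsteinCoeff.unique {n : ℕ} {p : MvPolynomial (Fin n) ℝ} {k : ℕ} {V : Simplex n}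
    {b b' : (Fin (n + 1) → ℕ) → ℝ} (hb : IsBernsteinCoeff p k V b)
    (hb' : IsBernsteinCoeff p k V b') : b = b' := by
  classical
  let G : MvPolynomial (Fin (n + 1)) ℝ := ∑ α ∈ multiIndices n k,
    MvPolynomial.monomial (Finsupp.equivFunOnFinite.symm α)
      ((b α - b' α) * Nat.multinomial Finset.univ α)
  have hev : ∀ lam : Fin (n + 1) → ℝ, MvPolynomial.eval lam G =
      ∑ α ∈ multiIndices n k, b α * bernsteinPoly α lam -
      ∑ α ∈ multiIndices n k, b' α * bernsteinPoly α lam := by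
    intro lam
    rw [← Finset.sum_sub_distrib]
    simp only [G, map_sum, MvPolynomial.eval_monomial]
    refine Finset.sum_congr rfl fun α _ => ?_
    rw [Finsupp.prod_fintype _ _ (by simp)]
    simp only [bernsteinPoly, Finsupp.coe_equivFunOnFinite_symm]
    ring
  have h1 : ∀ lam : Fin (n + 1) → ℝ, ∑ i, lam i = 1 → MvPolynomial.eval lam G = 0 := by
    intro lam hlam
    rw [hev, ← hb.1 lam hlam, ← hb'.1 lam hlam, sub_self]
  have h2 : G * ∑ i, MvPolynomial.X i = 0 := by
    refine MvPolynomial.funext fun lam => ?_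
    by_cases hs : ∑ i, lam i = 0
    · simp [hs]
    · have h3 := h1 (fun i => (∑ i, lam i)⁻¹ * lam i) (by
        rw [← Finset.mul_sum]; exact inv_mul_cancel₀ hs)
      have h5 : MvPolynomial.eval (fun i => (∑ i, lam i)⁻¹ * lam i) G =
          (∑ i, lam i)⁻¹ ^ k * MvPolynomial.eval lam G := by
        simp only [G, map_sum, MvPolynomial.eval_monomial, Finset.mul_sum]
        refine Finset.sum_congr rfl fun α hα => ?_
        rw [Finsupp.prod_fintype _ _ (by simp), Finsupp.prod_fintype _ _ (by simp)]
        simp only [Finsupp.coe_equivFunOnFinite_symm, mul_pow, Finset.prod_mul_distrib]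
        rw [Finset.prod_pow_eq_pow_sum, mem_multiIndices.mp hα]
        ring
      rw [h5] at h3
      have h6 : MvPolynomial.eval lam G = 0 :=
        (mul_eq_zero.mp h3).resolve_left (pow_ne_zero _ (inv_ne_zero hs))
      simp [h6]
  have h3 : (∑ i, MvPolynomial.X i : MvPolynomial (Fin (n + 1)) ℝ) ≠ 0 := by
    intro h
    have := congrArg (MvPolynomial.eval (Pi.single (0 : Fin (n + 1)) (1 : ℝ))) h
    simp at this
  have h4 : G = 0 := (mul_eq_zero.mp h2).resolve_right h3
  funext α
  by_cases hα : α ∈ multiIndices n k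
  · have h5 := congrArg (MvPolynomial.coeff (Finsupp.equivFunOnFinite.symm α)) h4
    simp only [G, MvPolynomial.coeff_sum, MvPolynomial.coeff_monomial,
      EmbeddingLike.apply_eq_iff_eq, Finset.sum_ite_eq', hα, if_true,
      MvPolynomial.coeff_zero] at h5
    have := (mul_eq_zero.mp h5).resolve_right (multinomial_ne_zero α)
    linarith
  · rw [hb.2 α hα, hb'.2 α hα]

/-- The Bernstein coefficients `b_α(p, k, V)`, defined as the unique coefficients in the
Bernstein expansion; they exist for every `p` of degree at most `k`. -/
noncomputable def bernsteinCoeff {n : ℕ} (p : MvPolynomial (Fin n) ℝ) (k : ℕ) (V : Simplex n) :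
    (Fin (n + 1) → ℕ) → ℝ :=
  Classical.epsilon (IsBernsteinCoeff p k V)

theorem isBernsteinCoeff_bernsteinCoeff {n : ℕ} (p : MvPolynomial (Fin n) ℝ) (k : ℕ)
    (V : Simplex n) (hp : p.totalDegree ≤ k) :
    IsBernsteinCoeff p k V (bernsteinCoeff p k V) :=
  Classical.epsilon_spec (exists_isBernsteinCoeff p k V hp)

/-- The rational Bernstein coefficients `b_α(f, k, V) = b_α(p, k, V) / b_α(q, k, V)` of
`f = p / q`. -/
noncomputable def ratCoeff {n : ℕ} (p q : MvPolynomial (Fin n) ℝ) (k : ℕ) (V : Simplex n)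
    (α : Fin (n + 1) → ℕ) : ℝ :=
  bernsteinCoeff p k V α / bernsteinCoeff q k V α

/-- The value of the rational function `f = p / q` at `x`. -/
noncomputable def ratEval {n : ℕ} (p q : MvPolynomial (Fin n) ℝ) (x : Space n) : ℝ :=
  MvPolynomial.eval (fun j => x j) p / MvPolynomial.eval (fun j => x j) q

/-- The second difference
`b_{γ+eᵢ+eⱼ₋₁} + b_{γ+eᵢ₋₁+eⱼ} - b_{γ+eᵢ₋₁+eⱼ₋₁} - b_{γ+eᵢ+eⱼ}`.
Subtraction in `Fin (n + 1)` is cyclic, which is the convention `e₋₁ = eₙ`. -/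
noncomputable def secondDiff {n : ℕ} (p : MvPolynomial (Fin n) ℝ) (k : ℕ) (V : Simplex n)
    (γ : Fin (n + 1) → ℕ) (i j : Fin (n + 1)) : ℝ :=
  bernsteinCoeff p k V (γ + Pi.single i 1 + Pi.single (j - 1) 1)
    + bernsteinCoeff p k V (γ + Pi.single (i - 1) 1 + Pi.single j 1)
    - bernsteinCoeff p k V (γ + Pi.single (i - 1) 1 + Pi.single (j - 1) 1)
    - bernsteinCoeff p k V (γ + Pi.single i 1 + Pi.single j 1)

/-- `‖∇²p‖_∞`: the maximum of `|∇² b_{γ,i,j}(p, k, V)|` over `|γ| = k - 2` and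
`0 ≤ i < j ≤ n`. There are finitely many of them; for `k ≤ 1` there is none and the value
is `0`. -/
noncomputable def secondDiffNorm {n : ℕ} (p : MvPolynomial (Fin n) ℝ) (k : ℕ)
    (V : Simplex n) : ℝ :=
  sSup {r : ℝ | ∃ (γ : Fin (n + 1) → ℕ) (i j : Fin (n + 1)),
    (∑ s, γ s) + 2 = k ∧ i < j ∧ r = |secondDiff p k V γ i j|}

/-- `ζ = max {|min_α b_α(f, l, Δ)|, |max_α b_α(f, l, Δ)|}`. -/
noncomputable def zeta {n : ℕ} (p q : MvPolynomial (Fin n) ℝ) (l : ℕ) : ℝ :=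
  max |(multiIndices n l).inf' (multiIndices_nonempty n l) (ratCoeff p q l (stdSimplex n))|
    |(multiIndices n l).sup' (multiIndices_nonempty n l) (ratCoeff p q l (stdSimplex n))|

/-- The constant
`ω' = l n²(n+1)(n+2)²(n+3) / (576 min_α b_α(q, l, Δ)) (‖∇²p‖_∞ + ζ ‖∇²q‖_∞)`. -/
noncomputable def omegaPrime {n : ℕ} (p q : MvPolynomial (Fin n) ℝ) (l : ℕ) : ℝ :=
  (l : ℝ) * (((n : ℝ) ^ 2 * (n + 1) * (n + 2) ^ 2 * (n + 3)) /
    (576 * (multiIndices n l).inf' (multiIndices_nonempty n l)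
      (bernsteinCoeff q l (stdSimplex n)))) *
    (secondDiffNorm p l (stdSimplex n) + zeta p q l * secondDiffNorm q l (stdSimplex n))

/-- The minimum of `f = p / q` over `Δ`. -/
noncomputable def minValue {n : ℕ} (p q : MvPolynomial (Fin n) ℝ) : ℝ :=
  sInf (ratEval p q '' realization (stdSimplex n))

/-- The certificate of positivity `Cert (b(f, k, V))`: all coefficients are nonnegative and
those at the vertices are positive. -/
def Cert {n : ℕ} (p q : MvPolynomial (Fin n) ℝ) (k : ℕ) (V : Simplex n) : Prop :=
  (∀ α ∈ multiIndices n k, 0 ≤ ratCoeff p q k V α) ∧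
  ∀ i : Fin (n + 1), 0 < ratCoeff p q k V (Pi.single i k)

/-- `L = (V¹, …, V^σ)` is a subdivision of the simplex `V`: the realizations cover exactly
`|V|` and their interiors are pairwise disjoint. -/
def IsSubdivision {n : ℕ} (V : Simplex n) (L : List (Simplex n)) : Prop :=
  (⋃ U ∈ L, realization U) = realization V ∧
  L.Pairwise fun U W => Disjoint (interior (realization U)) (interior (realization W))

/-- A subdivision scheme: a rule that subdivides every simplex. -/
structure SubdivisionScheme (n : ℕ) where
  /-- the subdivision `S(V)` of the simplex `V` -/
  subdivide : Simplex n → List (Simplex n)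
  isSubdivision : ∀ V, IsSubdivision V (subdivide V)

/-- `S^N(V)`: the list of simplices obtained from `V` after `N` successive subdivision steps. -/
def SubdivisionScheme.iter {n : ℕ} (S : SubdivisionScheme n) :
    ℕ → Simplex n → List (Simplex n)
  | 0, V => [V]
  | N + 1, V => (S.iter N V).flatMap S.subdivide

/-- `S` has the shrinking factor `C`, `0 < C < 1`: for every simplex `V`, the mesh of each
subsimplex in `S(V)` is at most `C` times the mesh of `V`. -/
def SubdivisionScheme.HasShrinkingFactor {n : ℕ} (S : SubdivisionScheme n) (C : ℝ) : Prop :=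
  0 < C ∧ C < 1 ∧ ∀ V : Simplex n, ∀ U ∈ S.subdivide V, mesh U ≤ C * mesh V

/-- The local certificate of positivity of `f = p / q` associated to a subdivision. -/
def LocalCert {n : ℕ} (p q : MvPolynomial (Fin n) ℝ) (k : ℕ) (L : List (Simplex n)) : Prop :=
  ∀ U ∈ L, Cert p q k U

end RatBernstein

namespace RatBernstein

/-! Fix the Bernstein coefficients `b` of `p` on `Δ` and let `Λ` be the linear functional `X^α ↦
b_α`. With `ℓ(y) = ∑ yᵢ Xᵢ` in barycentric coordinates of `Δ`, the value of `p` at `x` is `Λ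
(ℓ(x)^l)`, and the coefficient of index `α` on a simplex with vertices `uᵢ` is the blossom `Λ (∏
ℓ(uᵢ)^αᵢ)` (`bernsteinCoeff_eq_umbral`). Comparing a coefficient with the value at its control point
`v = ∑ αᵢ uᵢ / l` thus means comparing a product of `l` points with the power of their mean.

Replacing two points `m ± δ` by `m` adds `Λ (ℓ(δ)² ∏ rest)`. Summation by parts bounds this by the
second differences times `‖δ‖²` (`umbral_sq_mul_mono_le`), while the sum of the squared norms drops
by `2‖δ‖²`. A compactness argument then bounds the total error by the variance of the points
(`map_pow_le_map_prod`), hence by the squared mesh (`weighted_variance_le`).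

The estimate is applied to `p - f(v) q`, which vanishes at `v`. With `0 < f(v) ≤ ζ` it gives `b_α(p,
U) ≥ min b(q) (min f - ω' mesh(U)²)`. Since `mesh(U)² ≤ 2 C^(2N)`, the condition on `N` makes this
positive; so all coefficients on `U`, not only those at the vertices, are strictly positive. -/

/-! ### Bernstein coefficients as values of a linear functional -/

open MvPolynomial in
/-- The linear form `∑ yᵢ Xᵢ`. -/
noncomputable def linForm {n : ℕ} :
    (Fin (n + 1) → ℝ) →ₗ[ℝ] MvPolynomial (Fin (n + 1)) ℝ :=
  Fintype.linearCombination ℝ (X : Fin (n + 1) → MvPolynomial (Fin (n + 1)) ℝ)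

theorem linForm_apply {n : ℕ} (y : Fin (n + 1) → ℝ) :
    linForm y = ∑ i, y i • (MvPolynomial.X i : MvPolynomial (Fin (n + 1)) ℝ) :=
  Fintype.linearCombination_apply ℝ _ y

/-- The monomial `X^γ`. -/
noncomputable def mono {n : ℕ} (γ : Fin (n + 1) → ℕ) : MvPolynomial (Fin (n + 1)) ℝ :=
  ∏ i, MvPolynomial.X i ^ γ i

theorem mono_eq_monomial {n : ℕ} (γ : Fin (n + 1) → ℕ) :
    mono γ = MvPolynomial.monomial (Finsupp.equivFunOnFinite.symm γ) (1 : ℝ) := by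
  rw [MvPolynomial.monomial_eq, Finsupp.prod_fintype _ _ (by simp)]
  simp [mono]

theorem mono_add {n : ℕ} (γ δ : Fin (n + 1) → ℕ) : mono (γ + δ) = mono γ * mono δ := by
  simp [mono, pow_add, Finset.prod_mul_distrib]

theorem mono_single {n : ℕ} (i : Fin (n + 1)) : mono (Pi.single i 1) = MvPolynomial.X i := by
  classical
  simp [mono, Pi.single_apply, pow_ite, Finset.prod_ite_eq']

/-- The umbral functional `X^α ↦ b_α`. -/
noncomputable def umbral {n : ℕ} (b : (Fin (n + 1) → ℕ) → ℝ) :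
    MvPolynomial (Fin (n + 1)) ℝ →ₗ[ℝ] ℝ :=
  (MvPolynomial.basisMonomials (Fin (n + 1)) ℝ).constr ℝ fun s => b s

theorem umbral_mono {n : ℕ} (b : (Fin (n + 1) → ℕ) → ℝ) (γ : Fin (n + 1) → ℕ) :
    umbral b (mono γ) = b γ := by
  have h := (MvPolynomial.basisMonomials (Fin (n + 1)) ℝ).constr_basis ℝ
    (fun s => b s) (Finsupp.equivFunOnFinite.symm γ)
  rw [MvPolynomial.coe_basisMonomials] at h
  rw [mono_eq_monomial]
  simpa [umbral] using h

/-- Expansion of a power of a combination of ring elements in terms of Bernstein polynomials. -/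
theorem sum_smul_pow_eq {n : ℕ} (k : ℕ) (lam : Fin (n + 1) → ℝ)
    (f : Fin (n + 1) → MvPolynomial (Fin (n + 1)) ℝ) :
    (∑ i, lam i • f i) ^ k =
      ∑ α ∈ multiIndices n k, bernsteinPoly α lam • ∏ i, f i ^ α i := by
  rw [Finset.sum_pow_eq_sum_piAntidiag]
  refine Finset.sum_congr rfl fun α _ => ?_
  simp only [bernsteinPoly, smul_pow]
  rw [Finset.prod_smul, mul_smul, ← nsmul_eq_mul, Nat.cast_smul_eq_nsmul]

theorem umbral_linForm_pow {n : ℕ} (b : (Fin (n + 1) → ℕ) → ℝ) (k : ℕ)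
    (lam : Fin (n + 1) → ℝ) :
    umbral b (linForm lam ^ k) = ∑ α ∈ multiIndices n k, b α * bernsteinPoly α lam := by
  rw [linForm_apply, sum_smul_pow_eq, map_sum]
  refine Finset.sum_congr rfl fun α _ => ?_
  rw [map_smul, ← mono, umbral_mono, smul_eq_mul, mul_comm]

/-- The barycentric coordinates with respect to the standard simplex. -/
def bary {n : ℕ} (x : Space n) : Fin (n + 1) → ℝ := Fin.cons (1 - ∑ j, x j) fun j => x j

theorem sum_bary {n : ℕ} (x : Space n) : ∑ i, bary x i = 1 := by
  simp [bary, Fin.sum_univ_succ]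

theorem sum_bary_smul {n : ℕ} (x : Space n) :
    ∑ i, bary x i • (stdSimplex n).points i = x := by
  ext j
  simp [bary, stdSimplex, stdVertex, Fin.sum_univ_succ, Pi.single_apply]

theorem bary_sum {n : ℕ} {ι : Type*} [Fintype ι] (w : ι → ℝ) (hw : ∑ i, w i = 1)
    (u : ι → Space n) : bary (∑ i, w i • u i) = ∑ i, w i • bary (u i) := by
  funext j
  refine Fin.cases ?_ (fun j => ?_) j
  · simp [bary, mul_sub, hw, Finset.mul_sum]
    exact Finset.sum_comm
  · simp [bary]

theorem bary_nonneg {n : ℕ} {x : Space n} (hx : x ∈ realization (stdSimplex n))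
    (i : Fin (n + 1)) : 0 ≤ bary x i := by
  obtain ⟨ι, _, w, z, hw, hs, hz, rfl⟩ := mem_convexHull_iff_exists_fintype.mp hx
  rw [bary_sum w hs, Finset.sum_apply]
  refine Finset.sum_nonneg fun j _ => mul_nonneg (hw j) ?_
  obtain ⟨m, hm⟩ := hz j
  rw [← hm]
  refine Fin.cases ?_ (fun m => ?_) m <;> refine Fin.cases ?_ (fun i => ?_) i <;>
    simp [bary, stdSimplex, stdVertex]
  split_ifs <;> norm_num

theorem eval_eq_umbral {n : ℕ} (p : MvPolynomial (Fin n) ℝ) (k : ℕ) (hp : p.totalDegree ≤ k)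
    (x : Space n) : MvPolynomial.eval (fun j => x j) p =
      umbral (bernsteinCoeff p k (stdSimplex n)) (linForm (bary x) ^ k) := by
  have h := (isBernsteinCoeff_bernsteinCoeff p k (stdSimplex n) hp).1 (bary x) (sum_bary x)
  rw [sum_bary_smul] at h
  rw [h, umbral_linForm_pow]

/-- The multinomial expansion of `ℓ(∑ lamᵢ uᵢ)^k` exhibits a Bernstein expansion of `p` on `U`;
uniqueness identifies its coefficients. -/
theorem bernsteinCoeff_eq_umbral {n : ℕ} (p : MvPolynomial (Fin n) ℝ) (k : ℕ)
    (hp : p.totalDegree ≤ k) (U : Simplex n) {α : Fin (n + 1) → ℕ} (hα : α ∈ multiIndices n k) :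
    bernsteinCoeff p k U α = umbral (bernsteinCoeff p k (stdSimplex n))
      (∏ i, linForm (bary (U.points i)) ^ α i) := by
  classical
  have h : IsBernsteinCoeff p k U fun α => if α ∈ multiIndices n k then
      umbral (bernsteinCoeff p k (stdSimplex n))
        (∏ i, linForm (bary (U.points i)) ^ α i) else 0 := by
    refine ⟨fun lam hlam => ?_, fun α hα => if_neg hα⟩
    rw [eval_eq_umbral p k hp, bary_sum lam hlam, map_sum]
    simp only [map_smul]
    rw [sum_smul_pow_eq, map_sum]
    refine Finset.sum_congr rfl fun α hα => ?_
    rw [if_pos hα, map_smul, smul_eq_mul, mul_comm]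
  rw [(isBernsteinCoeff_bernsteinCoeff p k U hp).unique h]
  exact if_pos hα

/-- A lower bound on degree-`|s|` monomials persists on products of `|s|` points of the simplex. -/
theorem le_map_prod_linForm {n : ℕ} {ι : Type*} (m : ℝ) (s : Finset ι)
    (y : ι → Fin (n + 1) → ℝ) (hy : ∀ k ∈ s, y k ∈ _root_.stdSimplex ℝ (Fin (n + 1)))
    (Λ : MvPolynomial (Fin (n + 1)) ℝ →ₗ[ℝ] ℝ)
    (hΛ : ∀ γ : Fin (n + 1) → ℕ, ∑ i, γ i = s.card → m ≤ Λ (mono γ)) :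
    m ≤ Λ (∏ k ∈ s, linForm (y k)) := by
  classical
  induction s using Finset.induction_on generalizing Λ with
  | empty => simpa [mono] using hΛ 0 (by simp)
  | insert a s ha ih =>
    rw [Finset.prod_insert ha, linForm_apply, Finset.sum_mul, map_sum]
    -- Expanding one factor as a convex combination of the `Xᵢ` moves `Xᵢ` into the functional,
    -- which is why `Λ` is generalized in the induction.
    have h : ∀ i, m ≤ Λ (MvPolynomial.X i * ∏ k ∈ s, linForm (y k)) := fun i => by
      refine ih (fun k hk => hy k (Finset.mem_insert_of_mem hk))
        (Λ ∘ₗ LinearMap.mulLeft ℝ (MvPolynomial.X i)) fun γ hγ => ?_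
      have := hΛ (Pi.single i 1 + γ) (by
        simp [Finset.sum_add_distrib, hγ, Finset.card_insert_of_notMem ha, add_comm])
      rwa [mono_add, mono_single] at this
    obtain ⟨h0, h1⟩ := hy a (Finset.mem_insert_self a s)
    calc m = ∑ i, y a i * m := by rw [← Finset.sum_mul, h1, one_mul]
      _ ≤ _ := Finset.sum_le_sum fun i _ => by
        rw [smul_mul_assoc, map_smul, smul_eq_mul]
        exact mul_le_mul_of_nonneg_left (h i) (h0 i)

/-! ### Second differences control the functional on squares -/

/-- The squared Euclidean norm of `∑ dᵢ eᵢ`. -/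
def sqNorm {n : ℕ} (d : Fin (n + 1) → ℝ) : ℝ := ∑ j : Fin n, d j.succ ^ 2

/-- A cyclic primitive of `d` exists because `d` has sum zero; its increments are sums of
consecutive entries, so Cauchy–Schwarz bounds them. -/
theorem exists_primitive {n : ℕ} (d : Fin (n + 1) → ℝ) (hd : ∑ i, d i = 0) :
    ∃ a : Fin (n + 1) → ℝ, (∀ i, a i - a (i - 1) = d i) ∧
      ∀ i j, (a i - a j) ^ 2 ≤ |(i : ℝ) - (j : ℝ)| * sqNorm d := by
  let x : ℕ → ℝ := fun k => if h : k < n then d (Fin.succ ⟨k, h⟩) else 0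
  have hx : ∀ k : Fin n, x k = d k.succ := fun k => by simp [x]; rfl
  refine ⟨fun i => ∑ k ∈ Finset.range i, x k, fun i => ?_, ?_⟩
  · refine Fin.cases ?_ (fun j => ?_) i
    · rw [Fin.sum_univ_succ] at hd
      -- The wrap-around `a 0 - a n = d 0` is the place where `∑ d = 0` enters.
      have h : ((0 - 1 : Fin (n + 1)) : ℕ) = n := by simp
      simp only [h]
      simp only [← Fin.sum_univ_eq_sum_range, hx, Fin.val_zero]
      simp
      linarith
    · have h : j.succ - 1 = j.castSucc := by rw [← Fin.coeSucc_eq_succ, add_sub_cancel_right]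
      rw [h]
      simp [Finset.sum_range_succ, hx]
  · have key : ∀ i j : Fin (n + 1), i ≤ j →
        (∑ k ∈ Finset.range j, x k - ∑ k ∈ Finset.range i, x k) ^ 2 ≤
          ((j : ℝ) - (i : ℝ)) * sqNorm d := fun i j hij => by
      have hij' : (i : ℕ) ≤ j := hij
      rw [← Finset.sum_Ico_eq_sub _ hij']
      refine sq_sum_le_card_mul_sum_sq.trans ?_
      rw [Nat.card_Ico, Nat.cast_sub hij']
      refine mul_le_mul_of_nonneg_left ?_ (sub_nonneg.mpr (Nat.cast_le.mpr hij'))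
      have h : sqNorm d = ∑ k ∈ Finset.range n, x k ^ 2 := by
        rw [← Fin.sum_univ_eq_sum_range (fun k => x k ^ 2)]
        simp [sqNorm, hx]
      rw [h]
      refine Finset.sum_le_sum_of_subset_of_nonneg (fun k hk => ?_) fun _ _ _ => sq_nonneg _
      have := (Finset.mem_Ico.mp hk).2
      exact Finset.mem_range.mpr (by omega)
    intro i j
    rcases le_total i j with h | h
    · have h' : (i : ℝ) ≤ (j : ℝ) := Nat.cast_le.mpr h
      rw [abs_sub_comm, abs_of_nonneg (sub_nonneg.mpr h'), sub_sq_comm]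
      exact key i j h
    · have h' : (j : ℝ) ≤ (i : ℝ) := Nat.cast_le.mpr h
      rw [abs_of_nonneg (sub_nonneg.mpr h')]
      exact key j i h

theorem sum_abs_sub (n : ℕ) : ∑ i : Fin (n + 1), ∑ j : Fin (n + 1), |(i : ℝ) - (j : ℝ)| =
    (n : ℝ) * (n + 1) * (n + 2) / 3 := by
  have h1 : ∀ m : ℕ, ∑ i ∈ Finset.range m, |(i : ℝ) - m| = m * (m + 1) / 2 := fun m => by
    have h : ∀ i ∈ Finset.range m, |(i : ℝ) - m| = (m : ℝ) - i := fun i hi => by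
      rw [abs_sub_comm, abs_of_nonneg]
      exact sub_nonneg.mpr (Nat.cast_le.mpr (Finset.mem_range.mp hi).le)
    rw [Finset.sum_congr rfl h]
    clear h
    have h2 : ∀ k : ℕ, ∑ i ∈ Finset.range k, ((m : ℝ) - i) = k * m - k * (k - 1) / 2 := fun k => by
      induction k with
      | zero => simp
      | succ k ih => rw [Finset.sum_range_succ, ih]; push_cast; ring
    rw [h2]; ring
  have h : ∀ m : ℕ, ∑ i ∈ Finset.range m, ∑ j ∈ Finset.range m, |(i : ℝ) - (j : ℝ)| =
      ((m : ℝ) - 1) * m * (m + 1) / 3 := fun m => by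
    induction m with
    | zero => simp
    | succ m ih =>
      simp only [Finset.sum_range_succ, Finset.sum_add_distrib, ih, h1, sub_self, abs_zero]
      simp only [abs_sub_comm (m : ℝ), h1]
      push_cast; ring
  have h3 := h (n + 1)
  rw [← Fin.sum_univ_eq_sum_range
    (fun i => ∑ j ∈ Finset.range (n + 1), |(i : ℝ) - (j : ℝ)|)] at h3
  simp only [← Fin.sum_univ_eq_sum_range (fun j => |_ - (j : ℝ)|)] at h3
  rw [h3]; push_cast; ring

/-- Summation by parts, for the square of a linear form with coefficient sum zero. -/
theorem two_mul_linForm_sq {n : ℕ} (a d : Fin (n + 1) → ℝ) (ha : ∀ i, a i - a (i - 1) = d i) :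
    (2 : ℝ) • linForm d ^ 2 = -∑ i, ∑ j, ((a i - a j) ^ 2) •
      ((MvPolynomial.X i - MvPolynomial.X (i + 1)) *
        (MvPolynomial.X j - MvPolynomial.X (j + 1)) : MvPolynomial (Fin (n + 1)) ℝ) := by
  set D : Fin (n + 1) → MvPolynomial (Fin (n + 1)) ℝ :=
    fun i => MvPolynomial.X i - MvPolynomial.X (i + 1) with hD
  have h0 : ∑ i, D i = 0 := by
    rw [hD, Finset.sum_sub_distrib, sub_eq_zero]
    exact (Equiv.sum_comp (Equiv.addRight (1 : Fin (n + 1)))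
      (MvPolynomial.X : Fin (n + 1) → MvPolynomial (Fin (n + 1)) ℝ)).symm
  have h1 : linForm d = ∑ i, a i • D i := by
    simp only [hD, smul_sub, Finset.sum_sub_distrib, linForm_apply, ← ha, sub_smul]
    congr 1
    rw [← Equiv.sum_comp (Equiv.addRight (1 : Fin (n + 1)))]
    simp
  -- After expansion the terms with `aᵢ²` or `aⱼ²` vanish on summation because `∑ D = 0`; only the
  -- cross term `-2 ℓ(d)²` survives.
  have h2 : ∀ i j, ((a i - a j) ^ 2) • (D i * D j) =
      (a i ^ 2 • D i) * D j - (2 : ℝ) • ((a i • D i) * (a j • D j)) + D i * (a j ^ 2 • D j) := by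
    intro i j
    simp only [MvPolynomial.smul_eq_C_mul, map_pow, map_sub, map_ofNat]
    ring
  change _ = -∑ i, ∑ j, ((a i - a j) ^ 2) • (D i * D j)
  simp only [h2, Finset.sum_add_distrib, Finset.sum_sub_distrib, ← Finset.mul_sum,
    ← Finset.sum_mul, ← Finset.smul_sum, h0, ← h1]
  simp [sq]

/-- In the summation by parts the diagonal weights `(aᵢ - aᵢ)²` vanish, so the differences with `i <
j` suffice. The constant is half of `∑ |i - j| = n(n+1)(n+2)/3`. -/
theorem umbral_sq_mul_mono_le {n : ℕ} (b : (Fin (n + 1) → ℕ) → ℝ) (L : ℝ)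
    (γ : Fin (n + 1) → ℕ)
    (hL : ∀ i j, i < j → |b (γ + Pi.single i 1 + Pi.single (j - 1) 1)
      + b (γ + Pi.single (i - 1) 1 + Pi.single j 1)
      - b (γ + Pi.single (i - 1) 1 + Pi.single (j - 1) 1)
      - b (γ + Pi.single i 1 + Pi.single j 1)| ≤ L)
    (hL0 : 0 ≤ L) (d : Fin (n + 1) → ℝ) (hd : ∑ i, d i = 0) :
    umbral b (linForm d ^ 2 * mono γ) ≤ (n : ℝ) * (n + 1) * (n + 2) / 6 * L * sqNorm d := by
  obtain ⟨a, ha, ha2⟩ := exists_primitive d hd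
  set D : Fin (n + 1) → MvPolynomial (Fin (n + 1)) ℝ :=
    fun i => MvPolynomial.X i - MvPolynomial.X (i + 1) with hD
  have hDD : ∀ i j, umbral b (D (i - 1) * D (j - 1) * mono γ) =
      -(b (γ + Pi.single i 1 + Pi.single (j - 1) 1)
      + b (γ + Pi.single (i - 1) 1 + Pi.single j 1)
      - b (γ + Pi.single (i - 1) 1 + Pi.single (j - 1) 1)
      - b (γ + Pi.single i 1 + Pi.single j 1)) := fun i j => by
    simp only [← umbral_mono b, ← map_sub, ← map_add, ← map_neg, mono_add, mono_single, hD,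
      sub_add_cancel]
    congr 1
    ring
  have hlt : ∀ i j, i < j → |umbral b (D (i - 1) * D (j - 1) * mono γ)| ≤ L := fun i j hij => by
    rw [hDD, abs_neg]; exact hL i j hij
  -- The second differences involve `D (i - 1)` and `D (j - 1)`, hence the cyclic shift by one;
  -- symmetry covers the reversed order.
  have hne : ∀ i j, i ≠ j → |umbral b (D i * D j * mono γ)| ≤ L := fun i j hij => by
    rcases lt_or_gt_of_ne (fun h => hij (add_right_cancel h) : i + 1 ≠ j + 1) with h | h
    · simpa using hlt _ _ h
    · rw [mul_comm (D i)]
      simpa using hlt _ _ h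
  have hterm : ∀ i j, -((a i - a j) ^ 2 * umbral b (D i * D j * mono γ)) ≤
      L * (|(i : ℝ) - (j : ℝ)| * sqNorm d) := fun i j => by
    by_cases hij : i = j
    · simp [hij]
    · rw [← mul_neg, mul_comm L]
      have h1 := (neg_le_abs _).trans (hne i j hij)
      exact (mul_le_mul_of_nonneg_left h1 (sq_nonneg _)).trans
        (mul_le_mul_of_nonneg_right (ha2 i j) hL0)
  have h2 : 2 * umbral b (linForm d ^ 2 * mono γ) =
      ∑ i, ∑ j, -((a i - a j) ^ 2 * umbral b (D i * D j * mono γ)) := by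
    rw [← smul_eq_mul, ← map_smul, ← smul_mul_assoc, two_mul_linForm_sq a d ha]
    simp only [neg_mul, Finset.sum_mul, map_neg, map_sum, smul_mul_assoc, map_smul, smul_eq_mul,
      Finset.sum_neg_distrib, hD]
  have h3 : 2 * umbral b (linForm d ^ 2 * mono γ) ≤
      ∑ i : Fin (n + 1), ∑ j : Fin (n + 1), L * (|(i : ℝ) - (j : ℝ)| * sqNorm d) := by
    rw [h2]
    exact Finset.sum_le_sum fun i _ => Finset.sum_le_sum fun j _ => hterm i j
  simp only [← Finset.mul_sum, ← Finset.sum_mul, sum_abs_sub] at h3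
  linarith

/-! ### Averaging points: from a product to the power of the mean -/

theorem continuous_map_prod_linForm {n : ℕ} {ι : Type*} (s : Finset ι)
    (Λ : MvPolynomial (Fin (n + 1)) ℝ →ₗ[ℝ] ℝ) :
    Continuous fun z : ι → Fin (n + 1) → ℝ => Λ (∏ k ∈ s, linForm (z k)) := by
  classical
  induction s using Finset.induction_on generalizing Λ with
  | empty => simpa using continuous_const
  | insert a s ha ih =>
    simp only [Finset.prod_insert ha, linForm_apply (_ : Fin (n + 1) → ℝ), Finset.sum_mul, map_sum,
      smul_mul_assoc, map_smul, smul_eq_mul]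
    refine continuous_finsetSum _ fun i _ => Continuous.mul (by fun_prop) ?_
    simpa only [linForm_apply, LinearMap.comp_apply, LinearMap.mulLeft_apply] using ih (Λ ∘ₗ LinearMap.mulLeft ℝ (MvPolynomial.X i))

theorem continuous_sqNorm {n : ℕ} : Continuous (sqNorm (n := n)) := by
  unfold sqNorm; fun_prop

theorem sqNorm_nonneg {n : ℕ} (d : Fin (n + 1) → ℝ) : 0 ≤ sqNorm d :=
  Finset.sum_nonneg fun _ _ => sq_nonneg _

theorem eq_zero_of_sqNorm_eq_zero {n : ℕ} {d : Fin (n + 1) → ℝ} (hd : ∑ i, d i = 0)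
    (h : sqNorm d = 0) : d = 0 := by
  have h1 : ∀ j : Fin n, d j.succ = 0 := fun j => by
    have := (Finset.sum_eq_zero_iff_of_nonneg (fun _ _ => sq_nonneg _)).mp h j (Finset.mem_univ j)
    exact pow_eq_zero_iff two_ne_zero |>.mp this
  funext i
  refine Fin.cases ?_ h1 i
  simpa [Fin.sum_univ_succ, h1] using hd

theorem sqNorm_parallelogram {n : ℕ} (m δ : Fin (n + 1) → ℝ) :
    sqNorm (m + δ) + sqNorm (m - δ) = 2 * sqNorm m + 2 * sqNorm δ := by
  simp only [sqNorm, Finset.mul_sum, ← Finset.sum_add_distrib]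
  exact Finset.sum_congr rfl fun _ _ => by simp; ring

/-- This is `le_map_prod_linForm` for the functional `g ↦ -Λ (ℓ(d)² g)`. -/
theorem map_sq_mul_prod_le {n : ℕ} {ι : Type*} (Λ : MvPolynomial (Fin (n + 1)) ℝ →ₗ[ℝ] ℝ)
    (M : ℝ) (s : Finset ι) (d : Fin (n + 1) → ℝ)
    (hΛ : ∀ γ : Fin (n + 1) → ℕ, ∑ i, γ i = s.card → Λ (linForm d ^ 2 * mono γ) ≤ M)
    (y : ι → Fin (n + 1) → ℝ) (hy : ∀ k ∈ s, y k ∈ _root_.stdSimplex ℝ (Fin (n + 1))) :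
    Λ (linForm d ^ 2 * ∏ k ∈ s, linForm (y k)) ≤ M := by
  have := le_map_prod_linForm (-M) s y hy (-(Λ ∘ₗ LinearMap.mulLeft ℝ (linForm d ^ 2)))
    fun γ hγ => by simpa using hΛ γ hγ
  simpa using this

/-- Averaging two of the points lowers `Λ (∏ ℓ(zₖ)) + (M / 2) ∑ ‖zₖ‖²`, so its minimum at fixed
barycentre is attained when all the points coincide. -/
theorem map_pow_le_map_prod_of_lt {n : ℕ} {ι : Type*} [Fintype ι]
    (Λ : MvPolynomial (Fin (n + 1)) ℝ →ₗ[ℝ] ℝ) (M M' : ℝ) (hM : M < M')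
    (hΛ : ∀ d : Fin (n + 1) → ℝ, ∑ i, d i = 0 → ∀ γ : Fin (n + 1) → ℕ,
      ∑ i, γ i + 2 = Fintype.card ι → Λ (linForm d ^ 2 * mono γ) ≤ M * sqNorm d)
    (y : ι → Fin (n + 1) → ℝ) (hy : ∀ k, y k ∈ _root_.stdSimplex ℝ (Fin (n + 1)))
    (v : Fin (n + 1) → ℝ) (hv : (Fintype.card ι : ℝ) • v = ∑ k, y k) :
    Λ (linForm v ^ Fintype.card ι) + M' / 2 * (Fintype.card ι * sqNorm v) ≤
      Λ (∏ k, linForm (y k)) + M' / 2 * ∑ k, sqNorm (y k) := by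
  classical
  set F : (ι → Fin (n + 1) → ℝ) → ℝ :=
    fun z => Λ (∏ k, linForm (z k)) + M' / 2 * ∑ k, sqNorm (z k) with hF
  have hFc : Continuous F := (continuous_map_prod_linForm _ _).add
    (continuous_const.mul (continuous_finsetSum _ fun k _ =>
      continuous_sqNorm.comp (continuous_apply k)))
  set K : Set (ι → Fin (n + 1) → ℝ) :=
    (Set.univ.pi fun _ => _root_.stdSimplex ℝ (Fin (n + 1))) ∩ {z | ∑ k, z k = ∑ k, y k} with hK
  have hKc : IsCompact K := (isCompact_univ_pi fun _ => isCompact_stdSimplex ℝ _).inter_right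
    (isClosed_eq (by fun_prop) continuous_const)
  have hyK : y ∈ K := ⟨fun k _ => hy k, rfl⟩
  obtain ⟨z, ⟨hz, hzs⟩, hmin⟩ := hKc.exists_isMinOn ⟨y, hyK⟩ hFc.continuousOn
  have hz' : ∀ k, z k ∈ _root_.stdSimplex ℝ (Fin (n + 1)) := fun k => hz k (Set.mem_univ k)
  have heq : ∀ i j, z i = z j := by
    intro i j
    by_contra hne
    have hij : j ≠ i := fun h => hne (by rw [h])
    have hj : j ∈ Finset.univ.erase i := Finset.mem_erase.mpr ⟨hij, Finset.mem_univ j⟩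
    set s := (Finset.univ.erase i).erase j with hs
    set m : Fin (n + 1) → ℝ := (1 / 2 : ℝ) • z i + (1 / 2 : ℝ) • z j with hm
    set δ : Fin (n + 1) → ℝ := (1 / 2 : ℝ) • z i - (1 / 2 : ℝ) • z j with hδ
    have hzi : z i = m + δ := by rw [hm, hδ]; module
    have hzj : z j = m - δ := by rw [hm, hδ]; module
    have hδ0 : ∑ k, δ k = 0 := by
      simp [hδ, Finset.sum_sub_distrib, ← Finset.mul_sum, (hz' i).2, (hz' j).2]
    have hδpos : 0 < sqNorm δ := (sqNorm_nonneg δ).lt_of_ne fun h => hne <| by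
      rw [hzi, hzj, eq_zero_of_sqNorm_eq_zero hδ0 h.symm, add_zero, sub_zero]
    -- The competitor replaces both `z i` and `z j` by their midpoint, which keeps the sum of the
    -- points.
    set z' := Function.update (Function.update z i m) j m with hz'def
    have h1 : z' i = m := by simp [hz'def, Function.update_of_ne hij.symm]
    have h2 : z' j = m := by simp [hz'def]
    have h3 : ∀ k ∈ s, z' k = z k := fun k hk => by
      have hkj := Finset.ne_of_mem_erase hk
      have hki := Finset.ne_of_mem_erase (Finset.mem_of_mem_erase hk)
      rw [hz'def, Function.update_of_ne hkj, Function.update_of_ne hki]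
    have hprod : ∀ g : ι → MvPolynomial (Fin (n + 1)) ℝ,
        ∏ k, g k = g i * (g j * ∏ k ∈ s, g k) := fun g => by
      rw [hs, Finset.mul_prod_erase _ _ hj, Finset.mul_prod_erase _ _ (Finset.mem_univ i)]
    have hsum : ∀ {A : Type} [AddCommMonoid A] (g : ι → A),
        ∑ k, g k = g i + (g j + ∑ k ∈ s, g k) := fun g => by
      rw [hs, Finset.add_sum_erase _ _ hj, Finset.add_sum_erase _ _ (Finset.mem_univ i)]
    have hmK : m ∈ _root_.stdSimplex ℝ (Fin (n + 1)) :=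
      convex_stdSimplex ℝ _ (hz' i) (hz' j) (by norm_num) (by norm_num) (by norm_num)
    have hz'K : z' ∈ K := by
      refine ⟨fun k _ => ?_, ?_⟩
      · by_cases hkj : k = j
        · rw [hkj, h2]; exact hmK
        by_cases hki : k = i
        · rw [hki, h1]; exact hmK
        rw [h3 k (by simp [hs, hkj, hki])]; exact hz' k
      · change ∑ k, z' k = _
        rw [← (show ∑ k, z k = _ from hzs), hsum, hsum z, h1, h2, Finset.sum_congr rfl h3,
          hzi, hzj]
        module
    have hle : F z ≤ F z' := hmin hz'K
    have hcard : s.card + 2 = Fintype.card ι := by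
      have h5 := Finset.card_erase_add_one hj
      have h6 := Finset.card_erase_add_one (Finset.mem_univ i)
      rw [Finset.card_univ] at h6
      rw [hs]; omega
    have hΛs : Λ (linForm δ ^ 2 * ∏ k ∈ s, linForm (z k)) ≤ M * sqNorm δ :=
      map_sq_mul_prod_le Λ _ s δ (fun γ hγ => hΛ δ hδ0 γ (by rw [hγ, hcard])) z fun k _ => hz' k
    -- `ℓ(m + δ) ℓ(m - δ) = ℓ(m)² - ℓ(δ)²`.
    have hp : Λ (∏ k, linForm (z k)) = Λ (∏ k, linForm (z' k)) -
        Λ (linForm δ ^ 2 * ∏ k ∈ s, linForm (z k)) := by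
      rw [← map_sub, hprod, hprod fun k => linForm (z' k), h1, h2,
        Finset.prod_congr rfl fun k hk => congrArg linForm (h3 k hk), hzi, hzj,
        map_add linForm m δ, map_sub linForm m δ]
      congr 1
      ring
    have hq : ∑ k, sqNorm (z k) = ∑ k, sqNorm (z' k) + 2 * sqNorm δ := by
      rw [hsum, hsum fun k => sqNorm (z' k), h1, h2,
        Finset.sum_congr rfl fun k hk => congrArg sqNorm (h3 k hk), hzi, hzj]
      linarith [sqNorm_parallelogram m δ]
    -- Minimality would give `M' ‖δ‖² ≤ Λ (ℓ(δ)² ∏ rest) ≤ M ‖δ‖²`, impossible for `M < M'` and `δ ≠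
    -- 0`.
    simp only [hF, hp, hq] at hle
    nlinarith
  have hzv : ∀ k, z k = v := fun k => by
    have h : (Fintype.card ι : ℝ) • v = (Fintype.card ι : ℝ) • z k := by
      rw [hv, ← (show ∑ k, z k = _ from hzs), Finset.sum_congr rfl fun j _ => heq j k,
        Finset.sum_const, Finset.card_univ, Nat.cast_smul_eq_nsmul]
    have hc : (Fintype.card ι : ℝ) ≠ 0 := Nat.cast_ne_zero.mpr (Fintype.card_pos_iff.mpr ⟨k⟩).ne'
    exact (smul_right_injective _ hc h).symm
  have h : F z ≤ F y := hmin hyK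
  simpa [hF, hzv] using h

/-- Limit `M' → M` of the strict version: the set of admissible `M'` is closed and contains every
`M' > M`. -/
theorem map_pow_le_map_prod {n : ℕ} {ι : Type*} [Fintype ι]
    (Λ : MvPolynomial (Fin (n + 1)) ℝ →ₗ[ℝ] ℝ) (M : ℝ)
    (hΛ : ∀ d : Fin (n + 1) → ℝ, ∑ i, d i = 0 → ∀ γ : Fin (n + 1) → ℕ,
      ∑ i, γ i + 2 = Fintype.card ι → Λ (linForm d ^ 2 * mono γ) ≤ M * sqNorm d)
    (y : ι → Fin (n + 1) → ℝ) (hy : ∀ k, y k ∈ _root_.stdSimplex ℝ (Fin (n + 1)))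
    (v : Fin (n + 1) → ℝ) (hv : (Fintype.card ι : ℝ) • v = ∑ k, y k) :
    Λ (linForm v ^ Fintype.card ι) ≤
      Λ (∏ k, linForm (y k)) + M / 2 * (∑ k, sqNorm (y k) - Fintype.card ι * sqNorm v) := by
  set A := ∑ k, sqNorm (y k) - Fintype.card ι * sqNorm v with hA
  have h : Set.Ioi M ⊆ {M' : ℝ | Λ (linForm v ^ Fintype.card ι) ≤
      Λ (∏ k, linForm (y k)) + M' / 2 * A} := fun M' hM' => by
    have := map_pow_le_map_prod_of_lt Λ M M' hM' hΛ y hy v hv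
    simp only [Set.mem_ofPred_eq, hA]
    linarith
  have hc : IsClosed {M' : ℝ | Λ (linForm v ^ Fintype.card ι) ≤
      Λ (∏ k, linForm (y k)) + M' / 2 * A} := isClosed_le continuous_const (by fun_prop)
  have := closure_minimal h hc
  rw [closure_Ioi] at this
  exact this (Set.self_mem_Ici)

/-! ### Variance, distances and meshes -/

/-- The variance of points `uᵢ` with multiplicities `αᵢ`, bounded by their mutual distances. -/
theorem weighted_variance_le {n : ℕ} (α : Fin (n + 1) → ℕ) (l : ℕ) (hα : ∑ i, α i = l)
    (u : Fin (n + 1) → Fin (n + 1) → ℝ) (H : ℝ) (hH : ∀ i j, sqNorm (u i - u j) ≤ H)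
    (v : Fin (n + 1) → ℝ) (hv : (l : ℝ) • v = ∑ i, (α i : ℝ) • u i) :
    ∑ i, (α i : ℝ) * sqNorm (u i) - l * sqNorm v ≤ l * H * (n / (2 * (n + 1))) := by
  have hα' : ∑ i, (α i : ℝ) = l := by exact_mod_cast hα
  rcases Nat.eq_zero_or_pos l with rfl | hl
  · have : ∀ i, α i = 0 := by simpa using hα
    simp [this]
  have hl' : (0 : ℝ) < l := Nat.cast_pos.mpr hl
  -- The variance is expressed by pairwise distances, coordinate by coordinate.
  have h1 : ∑ i, ∑ j, (α i : ℝ) * α j * sqNorm (u i - u j) =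
      2 * l * (∑ i, (α i : ℝ) * sqNorm (u i) - l * sqNorm v) := by
    have hc : ∀ k : Fin n, ∑ i, ∑ j, (α i : ℝ) * α j * (u i k.succ - u j k.succ) ^ 2 =
        2 * l * (∑ i, (α i : ℝ) * u i k.succ ^ 2 - l * v k.succ ^ 2) := fun k => by
      have hvk : (l : ℝ) * v k.succ = ∑ i, (α i : ℝ) * u i k.succ := by
        simpa using congrFun hv k.succ
      have e : ∀ i j, (α i : ℝ) * α j * (u i k.succ - u j k.succ) ^ 2 =
          (α i * u i k.succ ^ 2) * α j + α i * (α j * u j k.succ ^ 2)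
            - 2 * ((α i * u i k.succ) * (α j * u j k.succ)) := fun i j => by ring
      simp only [e, Finset.sum_sub_distrib, Finset.sum_add_distrib, ← Finset.mul_sum,
        ← Finset.sum_mul, hα', ← hvk]
      ring
    have hs : ∑ i, ∑ j, (α i : ℝ) * α j * sqNorm (u i - u j) =
        ∑ k : Fin n, ∑ i, ∑ j, (α i : ℝ) * α j * (u i k.succ - u j k.succ) ^ 2 := by
      simp only [sqNorm, Finset.mul_sum, Pi.sub_apply]
      rw [Finset.sum_comm (s := (Finset.univ : Finset (Fin n)))]
      exact Finset.sum_congr rfl fun i _ => Finset.sum_comm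
    rw [hs]
    simp only [hc, sqNorm]
    rw [← Finset.mul_sum, Finset.sum_sub_distrib, Finset.sum_comm]
    simp only [← Finset.mul_sum]
  -- Dropping the zero diagonal leaves total weight `l² - ∑ αᵢ²`; Cauchy–Schwarz over the `n + 1`
  -- indices then yields the factor `n / (n + 1)`.
  have h2 : ∑ i, ∑ j, (α i : ℝ) * α j * sqNorm (u i - u j) ≤
      ((l : ℝ) ^ 2 - ∑ i, (α i : ℝ) ^ 2) * H := by
    have e : ((l : ℝ) ^ 2 - ∑ i, (α i : ℝ) ^ 2) * H =
        ∑ i, ∑ j, ((α i : ℝ) * α j - if i = j then (α i : ℝ) ^ 2 else 0) * H := by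
      simp only [← Finset.sum_mul, Finset.sum_sub_distrib, Finset.sum_ite_eq, Finset.mem_univ,
        if_true, ← Finset.mul_sum, hα', sq]
    rw [e]
    refine Finset.sum_le_sum fun i _ => Finset.sum_le_sum fun j _ => ?_
    split_ifs with h
    · subst h; simp [sqNorm, sq]
    · rw [sub_zero]
      exact mul_le_mul_of_nonneg_left (hH i j) (by positivity)
  have h3 : (l : ℝ) ^ 2 ≤ (n + 1) * ∑ i, (α i : ℝ) ^ 2 := by
    rw [← hα']
    simpa using sq_sum_le_card_mul_sum_sq (s := Finset.univ) (f := fun i => (α i : ℝ))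
  have hH0 : 0 ≤ H := (sqNorm_nonneg _).trans (hH 0 0)
  have h4 : ((l : ℝ) ^ 2 - ∑ i, (α i : ℝ) ^ 2) ≤ l ^ 2 * (n / (n + 1)) := by
    have hn : (0 : ℝ) < n + 1 := by positivity
    rw [← mul_div_assoc, le_div_iff₀ hn]
    nlinarith
  have h5 := h1 ▸ h2.trans (mul_le_mul_of_nonneg_right h4 hH0)
  refine le_of_mul_le_mul_left ?_ (by positivity : (0 : ℝ) < 2 * l)
  refine h5.trans_eq ?_
  have hn : (n : ℝ) + 1 ≠ 0 := by positivity
  field_simp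

theorem dist_sq_eq_sqNorm {n : ℕ} (x y : Space n) :
    dist x y ^ 2 = sqNorm (bary x - bary y) := by
  rw [EuclideanSpace.dist_eq, Real.sq_sqrt (Finset.sum_nonneg fun _ _ => sq_nonneg _)]
  simp [sqNorm, bary, Real.dist_eq]

theorem isCompact_realization {n : ℕ} (V : Simplex n) : IsCompact (realization V) :=
  (Set.finite_range V.points).isCompact_convexHull ℝ

theorem points_mem_realization {n : ℕ} (V : Simplex n) (i : Fin (n + 1)) :
    V.points i ∈ realization V := subset_convexHull ℝ _ ⟨i, rfl⟩

theorem bary_mem_stdSimplex {n : ℕ} {x : Space n} (hx : x ∈ realization (stdSimplex n)) :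
    bary x ∈ _root_.stdSimplex ℝ (Fin (n + 1)) := ⟨bary_nonneg hx, sum_bary x⟩

theorem mesh_nonneg {n : ℕ} (V : Simplex n) : 0 ≤ mesh V := Metric.diam_nonneg

theorem mesh_stdSimplex_sq_le (n : ℕ) : mesh (stdSimplex n) ^ 2 ≤ 2 := by
  have h : mesh (stdSimplex n) ≤ √2 := by
    refine Metric.diam_le_of_forall_dist_le (Real.sqrt_nonneg 2) fun x hx y hy => ?_
    refine Real.le_sqrt_of_sq_le ?_
    rw [dist_sq_eq_sqNorm]
    have hx' := bary_mem_stdSimplex hx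
    have hy' := bary_mem_stdSimplex hy
    have h1 : ∀ i, bary x i ≤ 1 := fun i => (mem_Icc_of_mem_stdSimplex hx' i).2
    have h2 : ∀ i, bary y i ≤ 1 := fun i => (mem_Icc_of_mem_stdSimplex hy' i).2
    -- For `s, t ∈ [0, 1]` one has `(s - t)² ≤ s + t`, and the coordinates of each point sum to at
    -- most `1`.
    have h3 : sqNorm (bary x - bary y) ≤ ∑ j : Fin n, (bary x j.succ + bary y j.succ) :=
      Finset.sum_le_sum fun j _ => by
        have a1 := hx'.1 j.succ
        have a2 := hy'.1 j.succ
        have a3 := mul_nonneg a1 a2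
        have a4 := mul_nonneg a1 (sub_nonneg.mpr (h1 j.succ))
        have a5 := mul_nonneg a2 (sub_nonneg.mpr (h2 j.succ))
        simp only [Pi.sub_apply]
        nlinarith
    have h4 := hx'.2
    have h5 := hy'.2
    rw [Fin.sum_univ_succ] at h4 h5
    rw [Finset.sum_add_distrib] at h3
    linarith [hx'.1 0, hy'.1 0]
  calc mesh (stdSimplex n) ^ 2 ≤ √2 ^ 2 := pow_le_pow_left₀ (mesh_nonneg _) h 2
    _ = 2 := Real.sq_sqrt (by norm_num)

theorem SubdivisionScheme.realization_subset_of_mem_iter {n : ℕ} (S : SubdivisionScheme n)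
    (V : Simplex n) (N : ℕ) : ∀ U ∈ S.iter N V, realization U ⊆ realization V := by
  induction N with
  | zero => intro U hU; rw [List.mem_singleton.mp hU]
  | succ N ih =>
    intro U hU
    obtain ⟨W, hW, hUW⟩ := List.mem_flatMap.mp hU
    refine subset_trans ?_ (ih W hW)
    rw [← (S.isSubdivision W).1]
    exact Set.subset_biUnion_of_mem (u := fun U => realization U) hUW

theorem SubdivisionScheme.HasShrinkingFactor.mesh_le {n : ℕ} {S : SubdivisionScheme n} {C : ℝ}
    (hC : S.HasShrinkingFactor C) (V : Simplex n) (N : ℕ) :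
    ∀ U ∈ S.iter N V, mesh U ≤ C ^ N * mesh V := by
  induction N with
  | zero => intro U hU; rw [List.mem_singleton.mp hU]; simp
  | succ N ih =>
    intro U hU
    obtain ⟨W, hW, hUW⟩ := List.mem_flatMap.mp hU
    calc mesh U ≤ C * mesh W := hC.2.2 W U hUW
      _ ≤ C * (C ^ N * mesh V) := mul_le_mul_of_nonneg_left (ih W hW) hC.1.le
      _ = C ^ (N + 1) * mesh V := by ring

/-! ### Coefficients on a subsimplex against values at control points -/

theorem secondDiffNorm_nonneg {n : ℕ} (p : MvPolynomial (Fin n) ℝ) (k : ℕ) (V : Simplex n) :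
    0 ≤ secondDiffNorm p k V :=
  Real.sSup_nonneg fun _ ⟨_, _, _, _, _, h⟩ => h ▸ abs_nonneg _

theorem abs_secondDiff_le {n : ℕ} (p : MvPolynomial (Fin n) ℝ) (k : ℕ) (V : Simplex n)
    {γ : Fin (n + 1) → ℕ} (hγ : ∑ s, γ s + 2 = k) {i j : Fin (n + 1)} (hij : i < j) :
    |secondDiff p k V γ i j| ≤ secondDiffNorm p k V := by
  refine le_csSup (Set.Finite.bddAbove ?_) ⟨γ, i, j, hγ, hij, rfl⟩
  refine (((multiIndices n (k - 2)) ×ˢ (Finset.univ ×ˢ Finset.univ)).image fun x =>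
    |secondDiff p k V x.1 x.2.1 x.2.2|).finite_toSet.subset ?_
  rintro r ⟨γ, i, j, h, -, rfl⟩
  simp only [Finset.coe_image, Set.mem_image, Finset.mem_coe]
  exact ⟨(γ, i, j), by simp [mem_multiIndices]; omega, rfl⟩

theorem umbral_sub {n : ℕ} (b b' : (Fin (n + 1) → ℕ) → ℝ) :
    umbral (b - b') = umbral b - umbral b' := by
  refine (MvPolynomial.basisMonomials _ ℝ).ext fun s => ?_
  simp [umbral, -MvPolynomial.coe_basisMonomials]

theorem umbral_smul {n : ℕ} (c : ℝ) (b : (Fin (n + 1) → ℕ) → ℝ) :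
    umbral (c • b) = c • umbral b := by
  refine (MvPolynomial.basisMonomials _ ℝ).ext fun s => ?_
  simp [umbral, -MvPolynomial.coe_basisMonomials]

/-- The sigma type lists each point `uᵢ` with multiplicity `αᵢ`, the form required by the averaging
argument. -/
theorem prod_linForm_pow_eq {n : ℕ} (α : Fin (n + 1) → ℕ) (u : Fin (n + 1) → Fin (n + 1) → ℝ) :
    ∏ i, linForm (u i) ^ α i = ∏ k : Σ i, Fin (α i), linForm (u k.1) := by
  simp [Fintype.prod_sigma]

theorem le_umbral_prod {n : ℕ} (b : (Fin (n + 1) → ℕ) → ℝ) (m : ℝ) (l : ℕ)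
    (hb : ∀ γ ∈ multiIndices n l, m ≤ b γ) {α : Fin (n + 1) → ℕ} (hα : α ∈ multiIndices n l)
    (u : Fin (n + 1) → Space n) (hu : ∀ i, u i ∈ realization (stdSimplex n)) :
    m ≤ umbral b (∏ i, linForm (bary (u i)) ^ α i) := by
  rw [prod_linForm_pow_eq]
  refine le_map_prod_linForm m _ _ (fun k _ => bary_mem_stdSimplex (hu k.1)) _ fun γ hγ => ?_
  rw [umbral_mono]
  refine hb γ (mem_multiIndices.mpr ?_)
  simpa [mem_multiIndices.mp hα] using hγ

theorem le_umbral_pow {n : ℕ} (b : (Fin (n + 1) → ℕ) → ℝ) (m : ℝ) (l : ℕ)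
    (hb : ∀ γ ∈ multiIndices n l, m ≤ b γ) {x : Space n}
    (hx : x ∈ realization (stdSimplex n)) :
    m ≤ umbral b (linForm (bary x) ^ l) := by
  -- The power is the product in which every point equals `x`; any `α` of total degree `l` would
  -- serve.
  have h := le_umbral_prod b m l hb (α := Pi.single 0 l) (by simp [mem_multiIndices])
    (fun _ => x) fun _ => hx
  rwa [Finset.prod_pow_eq_pow_sum, Finset.sum_pi_single', if_pos (Finset.mem_univ _)] at h

/-- Each Bernstein coefficient of a small simplex `U` is close to the value at its control point. -/
theorem umbral_pow_le_umbral_prod {n : ℕ} (b : (Fin (n + 1) → ℕ) → ℝ) (L : ℝ) (hL0 : 0 ≤ L)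
    (l : ℕ) (hL : ∀ γ : Fin (n + 1) → ℕ, ∑ s, γ s + 2 = l → ∀ i j, i < j →
      |b (γ + Pi.single i 1 + Pi.single (j - 1) 1)
      + b (γ + Pi.single (i - 1) 1 + Pi.single j 1)
      - b (γ + Pi.single (i - 1) 1 + Pi.single (j - 1) 1)
      - b (γ + Pi.single i 1 + Pi.single j 1)| ≤ L)
    {α : Fin (n + 1) → ℕ} (hα : α ∈ multiIndices n l)
    (U : Simplex n) (hU : realization U ⊆ realization (stdSimplex n))
    (v : Space n) (hv : (l : ℝ) • bary v = ∑ i, (α i : ℝ) • bary (U.points i)) :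
    umbral b (linForm (bary v) ^ l) ≤ umbral b (∏ i, linForm (bary (U.points i)) ^ α i) +
      l * ((n : ℝ) ^ 2 * (n + 2) / 24) * L * mesh U ^ 2 := by
  have hα' := mem_multiIndices.mp hα
  have hcard : Fintype.card (Σ i, Fin (α i)) = l := by simp [hα']
  have h1 := map_pow_le_map_prod (ι := Σ i, Fin (α i)) (umbral b)
    ((n : ℝ) * (n + 1) * (n + 2) / 6 * L)
    (fun d hd γ hγ => umbral_sq_mul_mono_le b L γ (hL γ (by rw [hγ, hcard])) hL0 d hd)
    (fun k => bary (U.points k.1))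
    (fun k => bary_mem_stdSimplex (hU (points_mem_realization U k.1))) (bary v)
    (by rw [hcard, hv, Fintype.sum_sigma]; simp [Nat.cast_smul_eq_nsmul])
  rw [hcard, ← prod_linForm_pow_eq α fun i => bary (U.points i)] at h1
  have h2 : ∑ k : Σ i, Fin (α i), sqNorm (bary (U.points k.1)) =
      ∑ i, (α i : ℝ) * sqNorm (bary (U.points i)) := by simp [Fintype.sum_sigma]
  have h3 := weighted_variance_le α l hα' (fun i => bary (U.points i)) (mesh U ^ 2)
    (fun i j => by
      rw [← dist_sq_eq_sqNorm]
      exact pow_le_pow_left₀ dist_nonneg (Metric.dist_le_diam_of_mem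
        (isCompact_realization U).isBounded (points_mem_realization U i)
        (points_mem_realization U j)) 2) (bary v) hv
  rw [h2] at h1
  refine h1.trans (add_le_add_right ?_ _)
  -- Half of `n(n+1)(n+2)/6` times `n / (2(n+1))` equals `n²(n+2)/24`.
  refine (mul_le_mul_of_nonneg_left h3 (by positivity)).trans_eq ?_
  have hn : (n : ℝ) + 1 ≠ 0 := by positivity
  field_simp
  ring

/-- The control point `(∑ αᵢ uᵢ) / l` of `U`. -/
theorem exists_control_point {n : ℕ} (U : Simplex n) {l : ℕ} {α : Fin (n + 1) → ℕ}
    (hα : α ∈ multiIndices n l) : ∃ v ∈ realization U,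
      (l : ℝ) • bary v = ∑ i, (α i : ℝ) • bary (U.points i) := by
  have hα' := mem_multiIndices.mp hα
  rcases Nat.eq_zero_or_pos l with rfl | hl
  · have h : ∀ i, α i = 0 := by simpa using hα'
    exact ⟨U.points 0, points_mem_realization U 0, by simp [h]⟩
  have hl' : (l : ℝ) ≠ 0 := Nat.cast_ne_zero.mpr hl.ne'
  have hw : ∑ i, (l : ℝ)⁻¹ * (α i : ℝ) = 1 := by
    rw [← Finset.mul_sum, ← Nat.cast_sum, hα', inv_mul_cancel₀ hl']
  refine ⟨∑ i, ((l : ℝ)⁻¹ * (α i : ℝ)) • U.points i, (convex_convexHull ℝ _).sum_mem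
    (fun i _ => by positivity) hw fun i _ => points_mem_realization U i, ?_⟩
  rw [bary_sum _ hw, Finset.smul_sum]
  refine Finset.sum_congr rfl fun i _ => ?_
  rw [smul_smul, mul_inv_cancel_left₀ hl']

/-! ### Positivity of both families of coefficients -/

section Positivity

variable {n : ℕ} {l : ℕ} {p q : MvPolynomial (Fin n) ℝ}

theorem eval_pos_of_bernsteinCoeff_pos (hq : q.totalDegree ≤ l)
    (hqpos : ∀ α ∈ multiIndices n l, 0 < bernsteinCoeff q l (stdSimplex n) α)
    {x : Space n} (hx : x ∈ realization (stdSimplex n)) :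
    0 < MvPolynomial.eval (fun j => x j) q := by
  rw [eval_eq_umbral q l hq]
  refine lt_of_lt_of_le ?_ (le_umbral_pow _
    ((multiIndices n l).inf' (multiIndices_nonempty n l) (bernsteinCoeff q l (stdSimplex n))) l
    (fun γ hγ => Finset.inf'_le _ hγ) hx)
  exact (Finset.lt_inf'_iff _).mpr hqpos

theorem ratEval_le_zeta (hp : p.totalDegree ≤ l) (hq : q.totalDegree ≤ l)
    (hqpos : ∀ α ∈ multiIndices n l, 0 < bernsteinCoeff q l (stdSimplex n) α)
    {x : Space n} (hx : x ∈ realization (stdSimplex n)) : ratEval p q x ≤ zeta p q l := by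
  refine le_trans ?_ ((le_abs_self _).trans (le_max_right _ _))
  rw [ratEval, div_le_iff₀ (eval_pos_of_bernsteinCoeff_pos hq hqpos hx), eval_eq_umbral p l hp,
    eval_eq_umbral q l hq]
  set s := (multiIndices n l).sup' (multiIndices_nonempty n l) (ratCoeff p q l (stdSimplex n))
  -- `s q - p` has nonnegative coefficients on `Δ`, hence nonnegative values there.
  have h := le_umbral_pow (s • bernsteinCoeff q l (stdSimplex n) -
    bernsteinCoeff p l (stdSimplex n)) 0 l (fun γ hγ => by
      have : ratCoeff p q l (stdSimplex n) γ ≤ s := Finset.le_sup' _ hγ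
      rw [ratCoeff, div_le_iff₀ (hqpos γ hγ)] at this
      simpa using this) hx
  rw [umbral_sub, umbral_smul] at h
  simpa using h

theorem exists_minValue_eq (hq : q.totalDegree ≤ l)
    (hqpos : ∀ α ∈ multiIndices n l, 0 < bernsteinCoeff q l (stdSimplex n) α) :
    ∃ x ∈ realization (stdSimplex n), ratEval p q x = minValue p q ∧
      ∀ y ∈ realization (stdSimplex n), minValue p q ≤ ratEval p q y := by
  have hc : ∀ r : MvPolynomial (Fin n) ℝ,
      Continuous fun x : Space n => MvPolynomial.eval (fun j => x j) r := fun r =>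
    (MvPolynomial.continuous_eval r).comp (by fun_prop)
  have hcont : ContinuousOn (ratEval p q) (realization (stdSimplex n)) :=
    (hc p).continuousOn.div (hc q).continuousOn fun x hx =>
      (eval_pos_of_bernsteinCoeff_pos hq hqpos hx).ne'
  obtain ⟨x, hx, hmin⟩ := (isCompact_realization (stdSimplex n)).exists_isMinOn
    ⟨_, points_mem_realization _ 0⟩ hcont
  have h : minValue p q = ratEval p q x :=
    IsLeast.csInf_eq ⟨⟨x, hx, rfl⟩, by rintro _ ⟨y, hy, rfl⟩; exact hmin hy⟩
  exact ⟨x, hx, h.symm, fun y hy => h ▸ hmin hy⟩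

/-- The numerator coefficients are positive on any simplex `U ⊆ Δ` of small mesh. -/
theorem bernsteinCoeff_pos_of_mesh_lt (hn : 1 ≤ n) (hp : p.totalDegree ≤ l)
    (hq : q.totalDegree ≤ l)
    (hqpos : ∀ α ∈ multiIndices n l, 0 < bernsteinCoeff q l (stdSimplex n) α)
    (hfpos : ∀ x ∈ realization (stdSimplex n), 0 < ratEval p q x)
    (U : Simplex n) (hU : realization U ⊆ realization (stdSimplex n))
    (hmesh : omegaPrime p q l * mesh U ^ 2 < minValue p q)
    {α : Fin (n + 1) → ℕ} (hα : α ∈ multiIndices n l) :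
    0 < bernsteinCoeff q l U α ∧ 0 < bernsteinCoeff p l U α := by
  set m := (multiIndices n l).inf' (multiIndices_nonempty n l)
    (bernsteinCoeff q l (stdSimplex n)) with hm
  have hm0 : 0 < m := (Finset.lt_inf'_iff _).mpr hqpos
  have hqm : m ≤ bernsteinCoeff q l U α := by
    rw [bernsteinCoeff_eq_umbral q l hq U hα]
    exact le_umbral_prod _ m l (fun γ hγ => Finset.inf'_le _ hγ) hα _
      fun i => hU (points_mem_realization U i)
  refine ⟨hm0.trans_le hqm, ?_⟩
  obtain ⟨v, hvU, hv⟩ := exists_control_point U hα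
  have hvΔ := hU hvU
  set φ := ratEval p q v with hφ
  have hφ0 : 0 < φ := hfpos v hvΔ
  have hφμ : minValue p q ≤ φ :=
    (exists_minValue_eq (p := p) hq hqpos).choose_spec.2.2 v hvΔ
  have hφζ : φ ≤ zeta p q l := ratEval_le_zeta hp hq hqpos hvΔ
  set P := secondDiffNorm p l (stdSimplex n) with hP
  set Q := secondDiffNorm q l (stdSimplex n) with hQ
  have hP0 : 0 ≤ P := secondDiffNorm_nonneg _ _ _
  have hQ0 : 0 ≤ Q := secondDiffNorm_nonneg _ _ _
  have hLζ : P + φ * Q ≤ P + zeta p q l * Q :=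
    add_le_add_right (mul_le_mul_of_nonneg_right hφζ hQ0) _
  -- Passing to `p - φ q` with `φ = f(v)` makes the value at the control point zero.
  have key := umbral_pow_le_umbral_prod (bernsteinCoeff p l (stdSimplex n) -
    φ • bernsteinCoeff q l (stdSimplex n)) (P + φ * Q) (by positivity) l
    (fun γ hγ i j hij => by
      have h1 := abs_secondDiff_le p l (stdSimplex n) hγ hij
      have h2 := abs_secondDiff_le q l (stdSimplex n) hγ hij
      calc _ = |secondDiff p l (stdSimplex n) γ i j - φ * secondDiff q l (stdSimplex n) γ i j| := by
            simp only [secondDiff, Pi.sub_apply, Pi.smul_apply, smul_eq_mul]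
            congr 1; ring
        _ ≤ _ := (abs_sub _ _).trans (add_le_add h1 (by
            rw [abs_mul, abs_of_pos hφ0]
            exact mul_le_mul_of_nonneg_left h2 hφ0.le))) hα U hU v hv
  simp only [umbral_sub, umbral_smul, LinearMap.sub_apply, LinearMap.smul_apply, smul_eq_mul,
    ← eval_eq_umbral p l hp, ← eval_eq_umbral q l hq, ← bernsteinCoeff_eq_umbral p l hp U hα,
    ← bernsteinCoeff_eq_umbral q l hq U hα] at key
  have hφeq : φ * MvPolynomial.eval (fun j => v j) q = MvPolynomial.eval (fun j => v j) p :=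
    div_mul_cancel₀ _ (eval_pos_of_bernsteinCoeff_pos hq hqpos hvΔ).ne'
  rw [hφeq, sub_self] at key
  -- The constant of `ω'` splits into the `n²(n+2)/24` obtained above and a surplus factor, at least
  -- `1` for `n ≥ 1`.
  have hω : m * omegaPrime p q l = l * ((n : ℝ) ^ 2 * (n + 2) / 24) *
      (((n : ℝ) + 1) * (n + 2) * (n + 3) / 24) * (P + zeta p q l * Q) := by
    rw [omegaPrime, ← hm, ← hP, ← hQ]
    field_simp
    ring
  have hn1 : (1 : ℝ) ≤ n := Nat.one_le_cast.mpr hn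
  have hK : 1 ≤ ((n : ℝ) + 1) * (n + 2) * (n + 3) / 24 := by
    rw [le_div_iff₀ (by norm_num), one_mul]
    calc (24 : ℝ) = (1 + 1) * (1 + 2) * (1 + 3) := by norm_num
      _ ≤ _ := by gcongr
  have hE : l * ((n : ℝ) ^ 2 * (n + 2) / 24) * (P + φ * Q) ≤ m * omegaPrime p q l := by
    rw [hω]
    refine mul_le_mul ?_ hLζ (by positivity) (by positivity)
    exact le_mul_of_one_le_right (by positivity) hK
  have h1 : m * (omegaPrime p q l * mesh U ^ 2) < m * minValue p q :=
    mul_lt_mul_of_pos_left hmesh hm0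
  have h2 := mul_le_mul_of_nonneg_right hE (sq_nonneg (mesh U))
  have h3 : m * minValue p q ≤ φ * bernsteinCoeff q l U α := by
    rw [mul_comm φ]
    exact (mul_le_mul_of_nonneg_left hφμ hm0.le).trans (mul_le_mul_of_nonneg_right hqm hφ0.le)
  linarith

theorem omegaPrime_nonneg
    (hqpos : ∀ α ∈ multiIndices n l, 0 < bernsteinCoeff q l (stdSimplex n) α) :
    0 ≤ omegaPrime p q l := by
  have hm0 := (Finset.lt_inf'_iff (multiIndices_nonempty n l)).mpr hqpos
  have hP := secondDiffNorm_nonneg p l (stdSimplex n)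
  have hQ := secondDiffNorm_nonneg q l (stdSimplex n)
  have hζ : 0 ≤ zeta p q l := (abs_nonneg _).trans (le_max_left _ _)
  unfold omegaPrime
  positivity

end Positivity

end RatBernstein

/-! ### The threshold on `N` -/

theorem mainTheorem3 {n : ℕ} (hn : 1 ≤ n) (l : ℕ) (p q : MvPolynomial (Fin n) ℝ)
    (hp : p.totalDegree ≤ l) (hq : q.totalDegree ≤ l)
    (hqpos : ∀ α ∈ RatBernstein.multiIndices n l,
      0 < RatBernstein.bernsteinCoeff q l (RatBernstein.stdSimplex n) α)
    (hfpos : ∀ x ∈ RatBernstein.realization (RatBernstein.stdSimplex n),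
      0 < RatBernstein.ratEval p q x)
    (S : RatBernstein.SubdivisionScheme n) (C : ℝ) (hC : S.HasShrinkingFactor C) (N : ℕ)
    (hN : 1 / C ^ N >
      √(2 * RatBernstein.omegaPrime p q l) / √(RatBernstein.minValue p q)) :
    (∀ U ∈ S.iter N (RatBernstein.stdSimplex n), ∀ α ∈ RatBernstein.multiIndices n l,
      0 < RatBernstein.bernsteinCoeff q l U α) ∧
    RatBernstein.LocalCert p q l (S.iter N (RatBernstein.stdSimplex n)) := by
  open RatBernstein in
  have hμ : 0 < minValue p q := by
    obtain ⟨x, hx, h, -⟩ := exists_minValue_eq (p := p) hq hqpos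
    exact h ▸ hfpos x hx
  have hω := omegaPrime_nonneg (p := p) hqpos
  have ht : 0 < C ^ N := pow_pos hC.1 N
  have h1 : 2 * omegaPrime p q l * (C ^ N) ^ 2 < minValue p q := by
    have h2 : √(2 * omegaPrime p q l) * C ^ N < √(minValue p q) := by
      have := (div_lt_div_iff₀ (Real.sqrt_pos.mpr hμ) ht).mp hN
      rwa [one_mul] at this
    have h3 := pow_lt_pow_left₀ h2 (by positivity) two_ne_zero
    rwa [mul_pow, Real.sq_sqrt (by positivity), Real.sq_sqrt hμ.le] at h3
  have h4 : ∀ U ∈ S.iter N (stdSimplex n), ∀ α ∈ multiIndices n l,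
      0 < bernsteinCoeff q l U α ∧ 0 < bernsteinCoeff p l U α := fun U hU α hα => by
    refine bernsteinCoeff_pos_of_mesh_lt hn hp hq hqpos hfpos U
      (S.realization_subset_of_mem_iter _ N U hU) ?_ hα
    refine lt_of_le_of_lt ?_ h1
    -- The factor `2` in the hypothesis on `N` is this bound for the squared diameter of `Δ`.
    have h5 : mesh U ^ 2 ≤ (C ^ N) ^ 2 * 2 := by
      refine (pow_le_pow_left₀ (mesh_nonneg U) (hC.mesh_le _ N U hU) 2).trans ?_
      rw [mul_pow]
      exact mul_le_mul_of_nonneg_left (mesh_stdSimplex_sq_le n) (sq_nonneg _)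
    calc omegaPrime p q l * mesh U ^ 2 ≤ omegaPrime p q l * ((C ^ N) ^ 2 * 2) :=
          mul_le_mul_of_nonneg_left h5 hω
      _ = _ := by ring
  refine ⟨fun U hU α hα => (h4 U hU α hα).1, fun U hU => ⟨fun α hα => ?_, fun i => ?_⟩⟩
  · exact (div_pos (h4 U hU α hα).2 (h4 U hU α hα).1).le
  · have hi : Pi.single i l ∈ multiIndices n l := by simp [mem_multiIndices]
    exact div_pos (h4 U hU _ hi).2 (h4 U hU _ hi).1
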